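/- Let $D\subset\mathbb{R}^n$ be a convex polytope, i.e. the convex hull of a finite set of points, let $D_0$ be the set of vertices (extreme points) of $D$, and let $\widetilde{D_1}$ be the graph of the 1-skeleton of $D$: its vertex set is $D_0$, and two different vertices $v,w$ are adjacent if the closed segment $[v,w]$ is an edge (a one-dimensional face) of $D$. Let $U\subset\mathbb{R}^n$ be a convex set (not necessarily closed or open). Let $\widetilde{D_1}\setminus U$ be the graph obtained from $\widetilde{D_1}$ by deleting all vertices that belong to $U$ and all edges $[v,w]$ with $[v,w]\cap U\neq\emptyset$. A path-connected component of a set $P\subset\mathbb{R}^n$ is a maximal (nonempty) path-connected subset of $P$. Then $D\setminus U$ has only finitely many path-connected components $W_1,\ldots,W_q$, the graph $\widetilde{D_1}\setminus U$ has exactly $q$ connected components, and there is a bijection between the path-connected components of $D\setminus U$ and the connected components of $\widetilde{D_1}\setminus U$ such that, for every $i$, the set $W_i\cap D_0$ is exactly the vertex set of the connected component of $\widetilde{D_1}\setminus U$ corresponding to $W_i$. -/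

import Mathlib

section Polytopes

variable {E : Type*} [AddCommGroup E] [Module ℝ E]

/-- A convex polytope (bounded convex polyhedron): the convex hull of a finite set of points. -/
def IsConvexPolytope (D : Set E) : Prop :=
  ∃ s : Set E, s.Finite ∧ D = convexHull ℝ s

/-- A nonempty (closed) face of `D`: a nonempty convex subset `F ⊆ D` such that every open segment
with end points in `D` that meets `F` has both of its end points in `F`. -/
structure IsFace (D F : Set E) : Prop where
  nonempty : F.Nonempty
  convex : Convex ℝ F
  isExtreme : IsExtreme ℝ D F

/-- An edge of `D`: a face whose affine hull has dimension one. -/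
def IsEdge (D F : Set E) : Prop :=
  IsFace D F ∧ Module.finrank ℝ (vectorSpan ℝ F) = 1

/-- The set of vertices of `D`. -/
abbrev vertices (D : Set E) : Set E := D.extremePoints ℝ

/-- The graph of the 1-skeleton of `D`: its vertices are the vertices of `D`; two different
vertices `v`, `w` are adjacent when the segment `[v, w]` is an edge of `D`. -/
def skeletonGraph (D : Set E) : SimpleGraph (vertices D) where
  Adj v w := v ≠ w ∧ IsEdge D (segment ℝ (v : E) (w : E))
  symm := ⟨fun v w h => ⟨h.1.symm, segment_symm ℝ (v : E) (w : E) ▸ h.2⟩⟩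
  loopless := ⟨fun _ h => h.1 rfl⟩

/-- The graph of the 1-skeleton of `D` minus `U`: delete the vertices that belong to `U` and the
edges `[v, w]` of `D` that have a nonempty intersection with `U`. -/
def cutGraph (D U : Set E) : SimpleGraph ↥(vertices D \ U) where
  Adj v w := (skeletonGraph D).Adj ⟨v, v.2.1⟩ ⟨w, w.2.1⟩ ∧
    segment ℝ (v : E) (w : E) ∩ U = ∅
  symm := ⟨fun v w h => ⟨h.1.symm, segment_symm ℝ (v : E) (w : E) ▸ h.2⟩⟩
  loopless := ⟨fun _ h => h.1.ne rfl⟩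

end Polytopes

/-- `W` is a path-connected component of `P`: a maximal path-connected (in particular nonempty)
subset of `P`. -/
def IsPathComponentOf {X : Type*} [TopologicalSpace X] (P W : Set X) : Prop :=
  Maximal (fun S : Set X => S ⊆ P ∧ IsPathConnected S) W

/-! ### Polytopes near a vertex -/

section

variable {E : Type*} [NormedAddCommGroup E] [NormedSpace ℝ E]

namespace IsConvexPolytope

variable {D : Set E}

/-! Edges disjoint from `U` are paths in `D \ U`, so graph components map to path components. This
map is onto because each point of `D \ U` sees a vertex: enlarge `U` to a convex set with convex
complement containing the point; some vertex lies in that complement (`exists_vertex_joinedIn`).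

It is injective because joined vertices are reachable. In an open half-space missing `U`, the
simplex method connects all vertices (`cutGraph_reachable_of_lt`). Two such half-spaces sharing a
point of `D` are interpolated (`cutGraph_reachable_of_common_point`). A path avoiding a closed
convex set is covered by such half-spaces, and a general `U` is replaced by a polytope inside it
that meets the same vertices and edges. -/

theorem isCompact (hD : IsConvexPolytope D) : IsCompact D := by
  obtain ⟨s, hs, rfl⟩ := hD
  exact hs.isCompact_convexHull ℝ

theorem convex (hD : IsConvexPolytope D) : Convex ℝ D := by
  obtain ⟨s, -, rfl⟩ := hD
  exact convex_convexHull ℝ s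

theorem finite_vertices (hD : IsConvexPolytope D) : (vertices D).Finite := by
  obtain ⟨s, hs, rfl⟩ := hD
  exact hs.subset extremePoints_convexHull_subset

theorem convexHull_vertices (hD : IsConvexPolytope D) : convexHull ℝ (vertices D) = D := by
  have h := closure_convexHull_extremePoints hD.isCompact hD.convex
  rwa [(hD.finite_vertices.isCompact_convexHull ℝ).isClosed.closure_eq] at h

theorem subset_of_vertices_subset (hD : IsConvexPolytope D) {C : Set E} (hC : Convex ℝ C)
    (h : vertices D ⊆ C) : D ⊆ C := by
  rw [← hD.convexHull_vertices]
  exact convexHull_min h hC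

theorem exists_vertex_le (hD : IsConvexPolytope D) (f : E →L[ℝ] ℝ) {x : E} (hx : x ∈ D) :
    ∃ v ∈ vertices D, f x ≤ f v := by
  by_contra! h
  have := hD.subset_of_vertices_subset (C := {y | f y < f x})
    (convex_halfSpace_lt f.toLinearMap.isLinear _) h hx
  exact lt_irrefl (f x) this

theorem notMem_convexHull_vertices_diff (hD : IsConvexPolytope D) {v : E}
    (hv : v ∈ vertices D) : v ∉ convexHull ℝ (vertices D \ {v}) := fun h =>
  ((hD.convex.mem_extremePoints_iff_mem_sdiff_convexHull_sdiff).1 hv).2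
    (convexHull_mono (Set.sdiff_subset_sdiff_left extremePoints_subset) h)

/-- A vertex of a polytope is strictly separated from the convex hull of the other vertices. -/
theorem exists_separating (hD : IsConvexPolytope D) {v : E} (hv : v ∈ vertices D) :
    ∃ (l : E →L[ℝ] ℝ) (c : ℝ), l v < c ∧ ∀ x ∈ convexHull ℝ (vertices D \ {v}), c < l x :=
  geometric_hahn_banach_point_closed (convex_convexHull _ _)
    ((hD.finite_vertices.subset Set.sdiff_subset).isCompact_convexHull ℝ).isClosed
    (hD.notMem_convexHull_vertices_diff hv)

theorem exists_mem_segment (hD : IsConvexPolytope D) {v x : E} (hv : v ∈ vertices D)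
    (hx : x ∈ D) (hxv : x ≠ v) :
    ∃ d ∈ convexHull ℝ (vertices D \ {v}), x ∈ segment ℝ v d := by
  have hi : insert v (vertices D \ {v}) = vertices D := by
    rw [Set.insert_sdiff_singleton, Set.insert_eq_of_mem hv]
  rw [← hD.convexHull_vertices, ← hi] at hx
  rcases (vertices D \ {v}).eq_empty_or_nonempty with he | hne
  · rw [he] at hx
    simp at hx
    exact absurd hx hxv
  · rw [convexHull_insert hne, convexJoin_singleton_left] at hx
    simpa using hx

/-- Every polytope is locally a cone at each of its vertices: a suitable hyperplane slice near the
vertex meets all rays from the vertex to other points of the polytope. -/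
theorem exists_vertex_slice (hD : IsConvexPolytope D) {v : E} (hv : v ∈ vertices D) :
    ∃ l : E →L[ℝ] ℝ, ∀ x ∈ D, x ≠ v → ∃ q ∈ D, l q = l v + 1 ∧
      ∃ t : ℝ, 0 < t ∧ x = v + t • (q - v) := by
  obtain ⟨l, c, hlv, hl⟩ := hD.exists_separating hv
  have hc : 0 < c - l v := by linarith
  -- Rescaling puts the separating level `c` exactly one unit above the value at `v`.
  refine ⟨(c - l v)⁻¹ • l, fun x hx hxv => ?_⟩
  obtain ⟨d, hd, hxd⟩ := hD.exists_mem_segment hv hx hxv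
  have hdD : d ∈ D := by
    rw [← hD.convexHull_vertices]
    exact convexHull_mono Set.sdiff_subset hd
  rw [segment_eq_image'] at hxd
  obtain ⟨θ, ⟨hθ0, -⟩, rfl⟩ := hxd
  have hθ : 0 < θ := by
    rcases hθ0.lt_or_eq with h | h
    · exact h
    · subst h; simp at hxv
  have hld : 0 < l d - l v := by linarith [hl d hd]
  -- The parameter at which the segment from `v` to `d` crosses the level `l = c`.
  set s := (c - l v) / (l d - l v) with hs
  have hs0 : 0 < s := div_pos hc hld
  have hs1 : s ≤ 1 := (div_le_one hld).2 (by linarith [hl d hd])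
  refine ⟨v + s • (d - v), ?_, ?_, θ / s, div_pos hθ hs0, ?_⟩
  · refine hD.convex.segment_subset hv.1 hdD ?_
    rw [segment_eq_image']
    exact ⟨s, ⟨hs0.le, hs1⟩, rfl⟩
  · have : l (v + s • (d - v)) = c := by
      simp only [map_add, map_smul, map_sub, smul_eq_mul, hs]
      field_simp
      ring
    simp only [smul_apply, this, smul_eq_mul]
    field_simp
    ring
  · rw [add_sub_cancel_left, smul_smul, div_mul_cancel₀ _ hs0.ne']

end IsConvexPolytope

/-! ### Edges that increase a functional -/

/-- Any continuous functional attains its maximum over a nonempty compact set at an extreme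
point. -/
theorem IsCompact.exists_extremePoint_isMaxOn {Q : Set E} (hQ : IsCompact Q) (hne : Q.Nonempty)
    (g : E →L[ℝ] ℝ) : ∃ q ∈ Q.extremePoints ℝ, ∀ x ∈ Q, g x ≤ g q := by
  have h : IsExposed ℝ Q {z ∈ Q | ∀ w ∈ Q, g w ≤ g z} := fun _ => ⟨g, rfl⟩
  obtain ⟨z, hz, hmax⟩ := hQ.exists_isMaxOn hne g.continuous.continuousOn
  obtain ⟨q, hq⟩ := (h.isCompact hQ).extremePoints_nonempty ⟨z, hz, hmax⟩
  exact ⟨q, h.isExtreme.extremePoints_subset_extremePoints hq, hq.1.2⟩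

variable {D : Set E}

/-- The part of a polytope on a ray from a vertex through an extreme point of a vertex slice is an
extreme set. -/
theorem isExtreme_ray {v q : E} {l : E →L[ℝ] ℝ} (hvD : v ∈ D)
    (hl : ∀ x ∈ D, x ≠ v → ∃ q ∈ D, l q = l v + 1 ∧ ∃ t : ℝ, 0 < t ∧ x = v + t • (q - v))
    (hq : q ∈ (D ∩ {x | l x = l v + 1}).extremePoints ℝ) :
    IsExtreme ℝ D {x ∈ D | ∃ t : ℝ, 0 ≤ t ∧ x = v + t • (q - v)} := by
  refine ⟨fun x hx => hx.1, fun x hx y hy z hz hzxy => ⟨hx, ?_⟩⟩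
  obtain ⟨hzD, t, ht, rfl⟩ := hz
  obtain ⟨a, b, ha, hb, hab, hz⟩ := hzxy
  by_cases hxv : x = v
  · exact ⟨0, le_rfl, by simp [hxv]⟩
  have hlq : l q = l v + 1 := hq.1.2
  obtain ⟨q₁, hq₁D, hq₁, s, hs, rfl⟩ := hl x hx hxv
  obtain rfl : b = 1 - a := by linarith
  by_cases hyv : y = v
  · subst hyv
    have hz' : (a * s) • (q₁ - y) = t • (q - y) := by
      have := congrArg (· - y) hz
      simp only [add_sub_cancel_left] at this
      rw [← this]
      module
    have hts : a * s = t := by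
      have := congrArg l hz'
      simpa [hq₁, hlq] using this
    rw [← hts] at hz'
    have := smul_right_injective E (mul_pos ha hs).ne' hz'
    exact ⟨s, hs.le, by rw [this]⟩
  obtain ⟨q₂, hq₂D, hq₂, r, hr, rfl⟩ := hl y hy hyv
  have hz' : (a * s) • (q₁ - v) + ((1 - a) * r) • (q₂ - v) = t • (q - v) := by
    have := congrArg (· - v) hz
    simp only [add_sub_cancel_left] at this
    rw [← this]
    module
  have hts : a * s + (1 - a) * r = t := by
    have := congrArg l hz'
    simpa [hq₁, hq₂, hlq] using this
  have ht0 : 0 < t := by rw [← hts]; positivity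
  -- Central projection from `v` onto the slice: `q` lies strictly between `q₁` and `q₂`, so
  -- extremality forces `q₁ = q`.
  have hmem : q ∈ openSegment ℝ q₁ q₂ := by
    refine ⟨a * s / t, (1 - a) * r / t, by positivity, by positivity, ?_, ?_⟩
    · rw [← add_div, hts, div_self ht0.ne']
    · apply smul_right_injective E ht0.ne'
      have e : t • q = t • (q - v) + t • v := by module
      simp only [smul_add, smul_smul, mul_div_cancel₀ _ ht0.ne']
      rw [e, ← hz', ← hts]
      module
  have := hq.2 ⟨hq₁D, hq₁⟩ ⟨hq₂D, hq₂⟩ hmem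
  exact ⟨s, hs.le, by rw [this]⟩

/-- The local step of the simplex method: from a vertex that does not maximize a functional there
is an edge along which the functional increases. -/
theorem IsConvexPolytope.exists_edge_lt (hD : IsConvexPolytope D) (g : E →L[ℝ] ℝ) {v x : E}
    (hv : v ∈ vertices D) (hx : x ∈ D) (hvx : g v < g x) :
    ∃ w ∈ vertices D, IsEdge D (segment ℝ v w) ∧ g v < g w := by
  obtain ⟨l, hl⟩ := hD.exists_vertex_slice hv
  have hcl : IsClosed {x | l x = l v + 1} := isClosed_eq l.continuous continuous_const
  obtain ⟨q', hq'D, hq', t', ht', rfl⟩ := hl x hx (by rintro rfl; exact lt_irrefl _ hvx)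
  obtain ⟨q, hq, hqmax⟩ := (hD.isCompact.inter_right hcl).exists_extremePoint_isMaxOn
    ⟨q', hq'D, hq'⟩ g
  have hgq : g v < g q := by
    refine lt_of_lt_of_le ?_ (hqmax q' ⟨hq'D, hq'⟩)
    simp only [map_add, map_smul, map_sub, smul_eq_mul] at hvx
    by_contra! h
    nlinarith
  have hlq : l q = l v + 1 := hq.1.2
  have hext := isExtreme_ray hv.1 hl hq
  set F := {x ∈ D | ∃ t : ℝ, 0 ≤ t ∧ x = v + t • (q - v)} with hF
  have hlt : ∀ t : ℝ, l (v + t • (q - v)) = l v + t := fun t => by simp [hlq]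
  -- The parameter on the ray is `l x - l v`; eliminating the quantifier shows that `F` is closed.
  have hFeq : F = D ∩ {x | l v ≤ l x ∧ x = v + (l x - l v) • (q - v)} := by
    ext y
    constructor
    · rintro ⟨hy, t, ht, rfl⟩
      refine ⟨hy, ?_, ?_⟩
      · rw [hlt]; linarith
      · rw [hlt, add_sub_cancel_left]
    · rintro ⟨hy, h1, h2⟩
      exact ⟨hy, _, sub_nonneg.2 h1, h2⟩
  have hFc : IsCompact F := by
    rw [hFeq]
    refine hD.isCompact.inter_right ((isClosed_le continuous_const l.continuous).inter
      (isClosed_eq continuous_id ?_))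
    fun_prop
  have hqF : q ∈ F := ⟨hq.1.1, 1, zero_le_one, by simp⟩
  -- The point of `F` farthest along the ray is the other end of the edge.
  obtain ⟨w, hwext, hwmax⟩ := hFc.exists_extremePoint_isMaxOn ⟨q, hqF⟩ l
  obtain ⟨hwD, M, hM, hw⟩ := hwext.1
  have hM1 : 1 ≤ M := by
    have := hwmax q hqF
    rw [hw, hlt, hlq] at this
    linarith
  have hseg : segment ℝ v w = F := by
    rw [segment_eq_image']
    ext y
    constructor
    · rintro ⟨θ, hθ, rfl⟩
      refine ⟨hD.convex.segment_subset hv.1 hwD ?_, θ * M, mul_nonneg hθ.1 hM, ?_⟩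
      · rw [segment_eq_image']
        exact ⟨θ, hθ, rfl⟩
      · simp only [hw, add_sub_cancel_left, smul_smul]
    · rintro ⟨hy, t, ht, rfl⟩
      have hM0 : 0 < M := by linarith
      have htM : t ≤ M := by
        have := hwmax _ ⟨hy, t, ht, rfl⟩
        rw [hw, hlt, hlt] at this
        linarith
      refine ⟨t / M, ⟨by positivity, (div_le_one hM0).2 htM⟩, ?_⟩
      simp only [hw, add_sub_cancel_left, smul_smul, div_mul_cancel₀ _ hM0.ne']
  have hgw : g v < g w := by
    rw [hw]
    simp only [map_add, map_smul, map_sub, smul_eq_mul]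
    nlinarith
  refine ⟨w, hext.extremePoints_subset_extremePoints hwext, ⟨⟨⟨v, left_mem_segment ℝ v w⟩,
    convex_segment v w, hseg ▸ hext⟩, ?_⟩, hgw⟩
  rw [vectorSpan_segment, finrank_span_singleton]
  intro h
  rw [sub_eq_zero.1 h] at hgw
  exact lt_irrefl _ hgw

/-! ### Half-spaces missing `U` and gluing of labels -/

/-- The vertices of a polytope in an open half-space that misses `U` lie in the same component of
the cut graph. -/
theorem IsConvexPolytope.cutGraph_reachable_of_lt (hD : IsConvexPolytope D) {U : Set E}
    (f : E →L[ℝ] ℝ) {b : ℝ} (hU : ∀ u ∈ U, f u ≤ b) (v w : ↥(vertices D \ U))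
    (hv : b < f v) (hw : b < f w) : (cutGraph D U).Reachable v w := by
  have hfin : Finite ↥(vertices D \ U) := (hD.finite_vertices.subset Set.sdiff_subset).to_subtype
  obtain ⟨m, hm, hmmax⟩ := Set.exists_max_image (Set.univ : Set ↥(vertices D \ U)) (fun x => f x)
    Set.finite_univ ⟨v, trivial⟩
  have hbm : b < f m := hv.trans_le (hmmax v trivial)
  suffices H : ∀ v : ↥(vertices D \ U), b < f v → (cutGraph D U).Reachable v m from
    (H v hv).trans (H w hw).symm
  clear! v w
  intro v hv
  have hnotU : ∀ u ∈ vertices D, b < f u → u ∈ vertices D \ U := fun u hu hbu =>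
    ⟨hu, fun h => (hU u h).not_gt hbu⟩
  have hfmax : ∀ u ∈ vertices D, f u ≤ f m := fun u hu => by
    by_contra! h
    exact h.not_ge (hmmax ⟨u, hnotU u hu (hbm.trans h)⟩ trivial)
  obtain ⟨l, c, hlm, hl⟩ := hD.exists_separating m.2.1
  -- A small tilt of `f` makes `m` the unique maximizing vertex, while vertices at least as high as
  -- `v` for the tilted functional still satisfy `b < f u`.
  have hε : ∃ ε : ℝ, 0 < ε ∧ ∀ u ∈ vertices D, b < f v + ε * (l u - l v) := by
    have h1 : ∀ᶠ ε : ℝ in nhdsWithin 0 (Set.Ioi 0),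
        ∀ u ∈ vertices D, b < f v + ε * (l u - l v) := by
      rw [hD.finite_vertices.eventually_all]
      intro u _
      have : ContinuousAt (fun ε : ℝ => f v + ε * (l u - l v)) 0 := by fun_prop
      exact (this.eventually_const_lt (by simpa using hv)).filter_mono nhdsWithin_le_nhds
    obtain ⟨ε, h2, h3⟩ := (h1.and self_mem_nhdsWithin).exists
    exact ⟨ε, h3, h2⟩
  obtain ⟨ε, hε0, hε⟩ := hε
  set g : E →L[ℝ] ℝ := f - ε • l with hg
  have hgm : ∀ u ∈ vertices D, u ≠ m → g u < g m := fun u hu hum => by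
    have h1 := hl u (subset_convexHull _ _ ⟨hu, hum⟩)
    have h2 := hfmax u hu
    have h3 : ε * l m < ε * l u := mul_lt_mul_of_pos_left (by linarith) hε0
    simp only [hg, sub_apply, smul_apply, smul_eq_mul]
    linarith
  have hgb : ∀ u ∈ vertices D, g v ≤ g u → b < f u := fun u hu huv => by
    have := hε u hu
    simp only [hg, sub_apply, smul_apply,
      smul_eq_mul] at huv
    linarith
  by_contra hvm
  -- Take the highest counterexample: an increasing edge from it leads to a vertex that is either
  -- joined to `m` or a higher counterexample.
  obtain ⟨u, ⟨hvu, hum⟩, humax⟩ := Set.exists_max_image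
    {u : ↥(vertices D \ U) | g v ≤ g u ∧ ¬ (cutGraph D U).Reachable u m} (fun x => g x)
    (Set.toFinite _) ⟨v, le_rfl, hvm⟩
  have hne : (u : E) ≠ m := fun h => hum (by rw [Subtype.ext h])
  obtain ⟨w, hw, hedge, huw⟩ := hD.exists_edge_lt g u.2.1 m.2.1.1 (hgm u u.2.1 hne)
  have hbw := hgb w hw (hvu.trans huw.le)
  have hbu := hgb u u.2.1 hvu
  have hadj : (cutGraph D U).Adj u ⟨w, hnotU w hw hbw⟩ := by
    refine ⟨⟨fun h => huw.ne (by rw [show (u : E) = w from congrArg Subtype.val h]), hedge⟩, ?_⟩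
    refine Set.eq_empty_of_forall_notMem fun z hz => (hU z hz.2).not_gt ?_
    exact (convex_halfSpace_gt f.toLinearMap.isLinear b).segment_subset hbu hbw hz.1
  by_cases hwm : (cutGraph D U).Reachable ⟨w, hnotU w hw hbw⟩ m
  · exact hum (hadj.reachable.trans hwm)
  · exact (humax ⟨w, hnotU w hw hbw⟩ ⟨hvu.trans huw.le, hwm⟩).not_gt huw

/-- If an open cover of a preconnected set is labelled so that overlapping members have equal
labels, then all members that meet the set have the same label. -/
theorem IsPreconnected.label_eq {X ι Q : Type*} [TopologicalSpace X] {S : Set X}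
    (hS : IsPreconnected S) {A : ι → Set X} (hA : ∀ i, IsOpen (A i)) (hcov : S ⊆ ⋃ i, A i)
    {c : ι → Q} (hc : ∀ i j, (S ∩ (A i ∩ A j)).Nonempty → c i = c j) {i j : ι}
    (hi : (S ∩ A i).Nonempty) (hj : (S ∩ A j).Nonempty) : c i = c j := by
  by_contra hij
  obtain ⟨x, hxS, hx1, hx2⟩ := hS (⋃ k ∈ {k | c k = c i}, A k) (⋃ k ∈ {k | c k ≠ c i}, A k)
    (isOpen_biUnion fun k _ => hA k) (isOpen_biUnion fun k _ => hA k)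
    (fun x hx => by
      obtain ⟨k, hk⟩ := Set.mem_iUnion.1 (hcov hx)
      by_cases h : c k = c i
      · exact Or.inl (Set.mem_biUnion h hk)
      · exact Or.inr (Set.mem_biUnion h hk))
    (hi.mono fun x hx => ⟨hx.1, Set.mem_biUnion (x := i) rfl hx.2⟩)
    (hj.mono fun x hx => ⟨hx.1, Set.mem_biUnion (x := j) (Ne.symm hij) hx.2⟩)
  simp only [Set.mem_iUnion, Set.mem_ofPred_eq] at hx1 hx2
  obtain ⟨k, hk, hxk⟩ := hx1
  obtain ⟨m, hm, hxm⟩ := hx2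
  exact hm ((hc m k ⟨x, hxS, hxm, hxk⟩).trans hk)

end

/-! ### From half-spaces to convex sets -/

section

variable {E : Type*} [NormedAddCommGroup E] [NormedSpace ℝ E]
variable {D : Set E}

/-- If two open half-spaces missing `U` share a point of the polytope, then the vertices in their
union lie in the same component of the cut graph. -/
theorem IsConvexPolytope.cutGraph_reachable_of_common_point (hD : IsConvexPolytope D) {U : Set E}
    {f₀ f₁ : E →L[ℝ] ℝ} {b₀ b₁ : ℝ} (h₀ : ∀ u ∈ U, f₀ u ≤ b₀) (h₁ : ∀ u ∈ U, f₁ u ≤ b₁)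
    {x : E} (hx : x ∈ D) (hx₀ : b₀ < f₀ x) (hx₁ : b₁ < f₁ x) {v w : ↥(vertices D \ U)}
    (hv : b₀ < f₀ v) (hw : b₁ < f₁ w) : (cutGraph D U).Reachable v w := by
  let f : ℝ → E →L[ℝ] ℝ := fun t => (1 - t) • f₀ + t • f₁
  let b : ℝ → ℝ := fun t => (1 - t) * b₀ + t * b₁
  have hf : ∀ t y, f t y = (1 - t) * f₀ y + t * f₁ y := fun t y => by simp [f]
  have hfU : ∀ t ∈ Set.Icc (0 : ℝ) 1, ∀ u ∈ U, f t u ≤ b t := fun t ht u hu => by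
    rw [hf]
    exact add_le_add (mul_le_mul_of_nonneg_left (h₀ u hu) (by linarith [ht.2]))
      (mul_le_mul_of_nonneg_left (h₁ u hu) ht.1)
  have hfx : ∀ t ∈ Set.Icc (0 : ℝ) 1, b t < f t x := fun t ht => by
    rw [hf]
    rcases ht.1.lt_or_eq with h | h
    · exact add_lt_add_of_le_of_lt (mul_le_mul_of_nonneg_left hx₀.le (by linarith [ht.2]))
        (mul_lt_mul_of_pos_left hx₁ h)
    · simpa [b, ← h] using hx₀
  rw [← SimpleGraph.ConnectedComponent.eq]
  -- Each vertex defines the open set of times `t` at which it lies in the moving half-space `b t <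
  -- f t`; these sets cover because `x` always lies in it.
  refine isPreconnected_Icc.label_eq (S := Set.Icc (0 : ℝ) 1)
    (A := fun v : ↥(vertices D \ U) => {t | b t < f t v}) (fun v => ?_) (fun t ht => ?_)
    (c := (cutGraph D U).connectedComponentMk) ?_
    ⟨0, by simp, by simpa [hf, b] using hv⟩ ⟨1, by simp, by simpa [hf, b] using hw⟩
  · simp only [hf, b]
    exact isOpen_lt (by fun_prop) (by fun_prop)
  · obtain ⟨v, hv, hxv⟩ := hD.exists_vertex_le (f t) hx
    have hbv := (hfx t ht).trans_le hxv
    exact Set.mem_iUnion.2 ⟨⟨v, hv, fun hvU => (hfU t ht v hvU).not_gt hbv⟩, hbv⟩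
  · rintro v w ⟨t, ht, hv, hw⟩
    exact SimpleGraph.ConnectedComponent.eq.2
      (hD.cutGraph_reachable_of_lt (f t) (hfU t ht) v w hv hw)

/-- Vertices in a connected subset of the complement of a closed convex set `K` in a polytope lie in
the same component of the cut graph. -/
theorem IsConvexPolytope.cutGraph_reachable_of_isClosed (hD : IsConvexPolytope D) {K : Set E}
    (hK : Convex ℝ K) (hKc : IsClosed K) {S : Set E} (hS : IsPreconnected S) (hSD : S ⊆ D \ K)
    {v w : ↥(vertices D \ K)} (hv : (v : E) ∈ S) (hw : (w : E) ∈ S) :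
    (cutGraph D K).Reachable v w := by
  -- Half-spaces missing `K`, each with a chosen vertex whose component serves as label.
  let ι := {p : (E →L[ℝ] ℝ) × ℝ × ↥(vertices D \ K) //
    (∀ u ∈ K, p.1 u ≤ p.2.1) ∧ p.2.1 < p.1 p.2.2}
  have hsep : ∀ x ∈ S, ∃ (f : E →L[ℝ] ℝ) (b : ℝ), (∀ u ∈ K, f u ≤ b) ∧ b < f x := fun x hx => by
    obtain ⟨f, b, h1, h2⟩ := geometric_hahn_banach_closed_point hK hKc (hSD hx).2
    exact ⟨f, b, fun u hu => (h1 u hu).le, h2⟩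
  obtain ⟨f, b, hfK, hfv⟩ := hsep v hv
  obtain ⟨g, c, hgK, hgw⟩ := hsep w hw
  rw [← SimpleGraph.ConnectedComponent.eq]
  refine hS.label_eq (ι := ι) (A := fun p => {x | p.1.2.1 < p.1.1 x})
    (fun p => isOpen_lt continuous_const p.1.1.continuous) (fun x hx => ?_)
    (c := fun p => (cutGraph D K).connectedComponentMk p.1.2.2) ?_
    (i := ⟨(f, b, v), hfK, hfv⟩) (j := ⟨(g, c, w), hgK, hgw⟩) ⟨v, hv, hfv⟩ ⟨w, hw, hgw⟩
  · obtain ⟨f, b, hfK, hfx⟩ := hsep x hx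
    obtain ⟨u, hu, hxu⟩ := hD.exists_vertex_le f (hSD hx).1
    have hbu := hfx.trans_le hxu
    exact Set.mem_iUnion.2
      ⟨⟨(f, b, ⟨u, hu, fun huK => (hfK u huK).not_gt hbu⟩), hfK, hbu⟩, hfx⟩
  · rintro ⟨⟨f, b, v⟩, hf, hv⟩ ⟨⟨g, c, w⟩, hg, hw⟩ ⟨x, hxS, hxf, hxg⟩
    exact SimpleGraph.ConnectedComponent.eq.2
      (hD.cutGraph_reachable_of_common_point hf hg (hSD hxS).1 hxf hxg hv hw)

/-- For the purposes of the cut graph, a convex set can be replaced by a polytope inside it. -/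
theorem IsConvexPolytope.exists_subset_meeting_same_edges (hD : IsConvexPolytope D) {U : Set E}
    (hU : Convex ℝ U) : ∃ K ⊆ U, IsConvexPolytope K ∧
      ∀ v ∈ vertices D, ∀ w ∈ vertices D, (segment ℝ v w ∩ U).Nonempty →
        (segment ℝ v w ∩ K).Nonempty := by
  -- Equal pairs are included, so that `K` also catches the vertices in `U`.
  let T : Set (E × E) :=
    {p ∈ vertices D ×ˢ vertices D | (segment ℝ p.1 p.2 ∩ U).Nonempty}
  have hT : ∀ p : T, (segment ℝ p.1.1 p.1.2 ∩ U).Nonempty := fun p => p.2.2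
  choose c hc using hT
  have : Finite T :=
    ((hD.finite_vertices.prod hD.finite_vertices).subset fun p hp => hp.1).to_subtype
  refine ⟨convexHull ℝ (Set.range c), convexHull_min ?_ hU, ⟨_, Set.finite_range c, rfl⟩,
    fun v hv w hw h => ?_⟩
  · rintro _ ⟨p, rfl⟩
    exact (hc p).2
  · let p : T := ⟨(v, w), ⟨hv, hw⟩, h⟩
    exact ⟨c p, (hc p).1, subset_convexHull _ _ ⟨p, rfl⟩⟩

/-- The path avoids the smaller closed set `K`, and passing from `K` back to `U` deletes no further
vertices or edges. -/
theorem IsConvexPolytope.cutGraph_reachable_of_joinedIn (hD : IsConvexPolytope D) {U : Set E}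
    (hU : Convex ℝ U) {v w : ↥(vertices D \ U)} (h : JoinedIn (D \ U) v w) :
    (cutGraph D U).Reachable v w := by
  obtain ⟨K, hKU, hK, hmeet⟩ := hD.exists_subset_meeting_same_edges hU
  have hvert : ∀ x ∈ vertices D, x ∉ K → x ∉ U := fun x hx hxK hxU => hxK <| by
    obtain ⟨y, hy, hyK⟩ := hmeet x hx x hx ⟨x, left_mem_segment ℝ x x, hxU⟩
    rw [segment_same] at hy
    rwa [← Set.mem_singleton_iff.1 hy]
  let φ : cutGraph D K →g cutGraph D U :=
    { toFun := fun x => ⟨x, x.2.1, hvert x x.2.1 x.2.2⟩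
      map_rel' := fun {x y} hxy => ⟨hxy.1, by
        by_contra hne
        obtain ⟨z, hz⟩ := hmeet x x.2.1 y y.2.1 (Set.nonempty_iff_ne_empty.2 hne)
        exact Set.notMem_empty z (hxy.2 ▸ hz)⟩ }
  obtain ⟨γ, hγ⟩ := h
  have := hD.cutGraph_reachable_of_isClosed hK.convex hK.isCompact.isClosed
    (S := Set.range γ) (isPreconnected_range γ.continuous)
    (by rintro _ ⟨t, rfl⟩; exact ⟨(hγ t).1, fun h => (hγ t).2 (hKU h)⟩)
    (v := ⟨v, v.2.1, fun h => v.2.2 (hKU h)⟩) (w := ⟨w, w.2.1, fun h => w.2.2 (hKU h)⟩)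
    ⟨0, γ.source⟩ ⟨1, γ.target⟩
  exact this.map φ

theorem joinedIn_of_segment_subset {P : Set E} {x y : E} (h : segment ℝ x y ⊆ P) :
    JoinedIn P x y :=
  (((convex_segment x y).isPathConnected ⟨x, left_mem_segment ℝ x y⟩).joinedIn x
    (left_mem_segment ℝ x y) y (right_mem_segment ℝ x y)).mono h

theorem IsConvexPolytope.joinedIn_of_cutGraph_reachable (hD : IsConvexPolytope D) {U : Set E}
    {v w : ↥(vertices D \ U)} (h : (cutGraph D U).Reachable v w) : JoinedIn (D \ U) v w := by
  rw [SimpleGraph.reachable_iff_reflTransGen] at h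
  induction h with
  | refl => exact JoinedIn.refl ⟨v.2.1.1, v.2.2⟩
  | @tail a b _ hab ih =>
    refine ih.trans (joinedIn_of_segment_subset fun z hz => ⟨?_, fun hzU => ?_⟩)
    · exact hD.convex.segment_subset a.2.1.1 b.2.1.1 hz
    · exact Set.notMem_empty z (hab.2 ▸ ⟨hz, hzU⟩)

/-- Every point of a polytope outside a convex set `U` sees a vertex outside `U`. -/
theorem IsConvexPolytope.exists_vertex_joinedIn (hD : IsConvexPolytope D) {U : Set E}
    (hU : Convex ℝ U) {x : E} (hx : x ∈ D \ U) :
    ∃ v : ↥(vertices D \ U), JoinedIn (D \ U) x v := by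
  obtain ⟨C, hC, hC', hUC, hxC⟩ := exists_convex_convex_compl_subset hU (convex_singleton (𝕜 := ℝ) x)
    (Set.disjoint_singleton_right.2 hx.2)
  have hxC' : x ∈ Cᶜ := hxC rfl
  obtain ⟨v, hv, hvC⟩ := Set.not_subset.1
    (fun h => hxC' (hD.subset_of_vertices_subset hC h hx.1))
  refine ⟨⟨v, hv, fun h => hvC (hUC h)⟩, joinedIn_of_segment_subset fun z hz => ⟨?_, fun h => ?_⟩⟩
  · exact hD.convex.segment_subset hx.1 hv.1 hz
  · exact hC'.segment_subset hxC' hvC hz (hUC h)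

end

/-! ### Path components and the bijection -/

section

variable {X : Type*} [TopologicalSpace X]

theorem isPathComponentOf_pathComponentIn {P : Set X} {x : X} (hx : x ∈ P) :
    IsPathComponentOf P (pathComponentIn P x) :=
  ⟨⟨pathComponentIn_subset, isPathConnected_pathComponentIn hx⟩, fun _ hS hle =>
    hS.2.subset_pathComponentIn (hle (mem_pathComponentIn_self hx)) hS.1⟩

theorem IsPathComponentOf.eq_pathComponentIn {P W : Set X} (h : IsPathComponentOf P W) {x : X}
    (hx : x ∈ W) : W = pathComponentIn P x :=
  have hsub := h.prop.2.subset_pathComponentIn hx h.prop.1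
  hsub.antisymm (h.le_of_ge ⟨pathComponentIn_subset,
    isPathConnected_pathComponentIn (h.prop.1 hx)⟩ hsub)

end

theorem proposition2p3 (n : ℕ) (D U : Set (EuclideanSpace ℝ (Fin n)))
    (hD : IsConvexPolytope D) (hU : Convex ℝ U) :
    {W | IsPathComponentOf (D \ U) W}.Finite ∧
      ∃ φ : {W // IsPathComponentOf (D \ U) W} ≃ (cutGraph D U).ConnectedComponent,
        ∀ W : {W // IsPathComponentOf (D \ U) W},
          Subtype.val '' (φ W).supp = W.1 ∩ vertices D := by
  have hfin : Finite ↥(vertices D \ U) := (hD.finite_vertices.subset Set.sdiff_subset).to_subtype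
  have hmem : ∀ v : ↥(vertices D \ U), (v : EuclideanSpace ℝ (Fin n)) ∈ D \ U :=
    fun v => ⟨v.2.1.1, v.2.2⟩
  have hiff : ∀ v w : ↥(vertices D \ U),
      (w : EuclideanSpace ℝ (Fin n)) ∈ pathComponentIn (D \ U) v ↔
        (cutGraph D U).Reachable v w := fun v w =>
    ⟨fun h => hD.cutGraph_reachable_of_joinedIn hU h, fun h => hD.joinedIn_of_cutGraph_reachable h⟩
  let ψ : (cutGraph D U).ConnectedComponent → {W // IsPathComponentOf (D \ U) W} :=
    Quot.lift (fun v => ⟨pathComponentIn (D \ U) v, isPathComponentOf_pathComponentIn (hmem v)⟩)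
      fun v w h => Subtype.ext (pathComponentIn_congr ((hiff v w).2 h)).symm
  have hψ : ∀ v, (ψ ((cutGraph D U).connectedComponentMk v)).1 = pathComponentIn (D \ U) v :=
    fun v => rfl
  have hbij : Function.Bijective ψ := by
    constructor
    · intro a b hab
      induction a using SimpleGraph.ConnectedComponent.ind with | h v =>
      induction b using SimpleGraph.ConnectedComponent.ind with | h w =>
      have h := congrArg Subtype.val hab
      rw [hψ, hψ] at h
      exact SimpleGraph.ConnectedComponent.eq.2
        ((hiff v w).1 (h ▸ mem_pathComponentIn_self (hmem w)))
    · rintro ⟨W, hW⟩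
      obtain ⟨x, hx⟩ := hW.prop.2.nonempty
      obtain ⟨v, hv⟩ := hD.exists_vertex_joinedIn hU (hW.prop.1 hx)
      refine ⟨(cutGraph D U).connectedComponentMk v, Subtype.ext ?_⟩
      exact (pathComponentIn_congr hv).trans (hW.eq_pathComponentIn hx).symm
  let φ := (Equiv.ofBijective ψ hbij).symm
  have : Finite {W // IsPathComponentOf (D \ U) W} := Finite.of_surjective ψ hbij.2
  refine ⟨Set.finite_coe_iff.1 this, φ, fun W => ?_⟩
  obtain ⟨C, rfl⟩ := hbij.2 W
  have hφ : φ (ψ C) = C := (Equiv.ofBijective ψ hbij).symm_apply_apply C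
  rw [hφ]
  induction C using SimpleGraph.ConnectedComponent.ind with | h v =>
  rw [hψ]
  ext x
  constructor
  · rintro ⟨w, hw, rfl⟩
    exact ⟨(hiff v w).2 (SimpleGraph.ConnectedComponent.eq.1 hw).symm, w.2.1⟩
  · rintro ⟨hx, hxv⟩
    let w : ↥(vertices D \ U) := ⟨x, hxv, (pathComponentIn_subset hx).2⟩
    exact ⟨w, SimpleGraph.ConnectedComponent.eq.2 ((hiff v w).1 hx).symm, rfl⟩
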